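/- Fix integers $k_1,k_2,k_3,d\ge 0$. For every $n$ let $p=p_n$ and consider (non-random) parameters $\alpha\in\mathbb R^n$, $Z=(Z_1\ Z_2\ Z_3)\in\mathbb R^{n\times(k_1+k_2+k_3)}$, $\Lambda=(\Lambda_2\ \Lambda_3)\in\mathbb R^{p\times(k_2+k_3)}$ and a diagonal matrix $\Psi\in\mathbb R^{p\times p}$, all of which may depend on $n$. Put $Z_{12}=(Z_1\ Z_2)$ and $P=\alpha 1_n^T+1_n\alpha^T+Z_{12}Z_{12}^T$. Assume that the following hold for all sufficiently large $n$: (a) all entries $P_{ij}$ lie in $[0,1]$, and $A\in\{0,1\}^{n\times n}$ is a random symmetric matrix with zero diagonal whose entries $A_{ij}$, $i<j$, are independent with $A_{ij}\sim\mathrm{Bernoulli}(P_{ij})$; (b) $P$ is positive semidefinite and $\max_{1\le i\le n}\sum_{j=1}^nP_{ij}>(\log n)^{4+a}$, for some constant $a>0$ independent of $n$; (c) $0<\Psi_{jj}\le C$ and $\|\lambda_j\|_2\le C$ for all $1\le j\le p$, where $\lambda_j$ is the $j$-th row of $\Lambda$, and the entries of $\lim_n Z^TZ/n$, if this limit exists,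 are at most $C$ in absolute value, for some constant $C>0$ independent of $n$; (d) the columns of $Z$ sum to zero, and one of the following holds: (1) $Z_{12}^TZ_3=0$, $\Lambda_2^T\Psi^{-1}\Lambda_2/p$ is diagonal with distinct diagonal elements, and $\Lambda_3$ contains the identity matrix $I_{k_3}$ as a submatrix; (2) $Z^TZ$ is diagonal with distinct diagonal elements and $\Lambda_3^T\Psi^{-1}\Lambda_3/p=I_{k_3}$; (3) $Z_{12}^TZ_3=0$, $Z_{12}^TZ_{12}$ has distinct eigenvalues, $Z_3^TZ_3$ is diagonal with distinct diagonal elements, $\Lambda_2$ is lower triangular and $\Lambda_3^T\Psi^{-1}\Lambda_3/p=I_{k_3}$. Let $X\in\mathbb R^{n\times d}$, with rows $x_1^T,\dots,x_n^T$, satisfy $P=XX^T$ for all sufficiently large $n$, and assume that $\overline M_X=\lim_{n\to\infty}X^TX/n$ exists. Let $\hat\alpha=n^{-1}(I-P_1/2)A1_n$, where $P_1=n^{-1}1_n1_n^T$. Then for each fixed $i$ for which the limit $\tilde Q_i=\lim_{n\to\infty}n^{-1}\sum_{j\ne i}x_i^Tx_j(1-x_i^Tx_j)$ exists, we have $\tilde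 Q_i\ge 0$ and, as $n\to\infty$, $$\sqrt n\,(\hat\alpha_i-\alpha_i)\ \longrightarrow\ \mathcal N(0,\tilde Q_i)\quad\text{in distribution},$$ where $\mathcal N(0,0)$ denotes the point mass at $0$. -/

import Mathlib

open MeasureTheory ProbabilityTheory Filter Topology Matrix

noncomputable section

/-- The (non-random) parameters of the generalized factor model with `n` observations and `p`
variables.  The columns of `Z = (Z₁ Z₂ Z₃)` are indexed by `(Fin k₁ ⊕ Fin k₂) ⊕ Fin k₃`, those of
`Λ = (Λ₂ Λ₃)` by `Fin k₂ ⊕ Fin k₃`; `Ψ` is the diagonal of the (diagonal) noise covariance. -/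
structure GFParams (n p k₁ k₂ k₃ : ℕ) where
  α : Fin n → ℝ
  Z : Matrix (Fin n) ((Fin k₁ ⊕ Fin k₂) ⊕ Fin k₃) ℝ
  Λ : Matrix (Fin p) (Fin k₂ ⊕ Fin k₃) ℝ
  Ψ : Fin p → ℝ

/-- The `i`-th entry (counted from `0`) of a vector of length `n`, with the value `0` if the vector
has no such entry.  It allows to fix `i` and let `n → ∞`. -/
def entry {n : ℕ} (v : Fin n → ℝ) (i : ℕ) : ℝ :=
  if h : i < n then v ⟨i, h⟩ else 0

/-- `M` is diagonal, with pairwise distinct diagonal entries. -/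
def IsDiagDistinct {m : Type*} (M : Matrix m m ℝ) : Prop :=
  M.IsDiag ∧ Function.Injective M.diag

/-- Every column of `M` sums to zero. -/
def IsCentered {n : ℕ} {m : Type*} (M : Matrix (Fin n) m ℝ) : Prop :=
  ∀ l, ∑ i, M i l = 0

namespace GFParams

variable {n p k₁ k₂ k₃ : ℕ}

def Z12 (θ : GFParams n p k₁ k₂ k₃) : Matrix (Fin n) (Fin k₁ ⊕ Fin k₂) ℝ := θ.Z.toCols₁

def Z3 (θ : GFParams n p k₁ k₂ k₃) : Matrix (Fin n) (Fin k₃) ℝ := θ.Z.toCols₂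

def Λ2 (θ : GFParams n p k₁ k₂ k₃) : Matrix (Fin p) (Fin k₂) ℝ := θ.Λ.toCols₁

def Λ3 (θ : GFParams n p k₁ k₂ k₃) : Matrix (Fin p) (Fin k₃) ℝ := θ.Λ.toCols₂

/-- `P = α 1ᵀ + 1 αᵀ + Z₁₂ Z₁₂ᵀ`. -/
def P (θ : GFParams n p k₁ k₂ k₃) : Matrix (Fin n) (Fin n) ℝ :=
  vecMulVec θ.α 1 + vecMulVec 1 θ.α + θ.Z12 * θ.Z12ᵀ

/-- First set of identifiability conditions. -/
def Ident1 (θ : GFParams n p k₁ k₂ k₃) : Prop :=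
  IsCentered θ.Z ∧ θ.Z12ᵀ * θ.Z3 = 0 ∧
    IsDiagDistinct ((p : ℝ)⁻¹ • (θ.Λ2ᵀ * (diagonal θ.Ψ)⁻¹ * θ.Λ2)) ∧
    ∃ r : Fin k₃ → Fin p, θ.Λ3.submatrix r id = 1

/-- Second set of identifiability conditions. -/
def Ident2 (θ : GFParams n p k₁ k₂ k₃) : Prop :=
  IsCentered θ.Z ∧ IsDiagDistinct (θ.Zᵀ * θ.Z) ∧
    (p : ℝ)⁻¹ • (θ.Λ3ᵀ * (diagonal θ.Ψ)⁻¹ * θ.Λ3) = 1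

/-- Third set of identifiability conditions.  A real symmetric matrix has distinct eigenvalues iff
its characteristic polynomial has no repeated real root. -/
def Ident3 (θ : GFParams n p k₁ k₂ k₃) : Prop :=
  IsCentered θ.Z ∧ θ.Z12ᵀ * θ.Z3 = 0 ∧
    (θ.Z12ᵀ * θ.Z12).charpoly.roots.Nodup ∧ IsDiagDistinct (θ.Z3ᵀ * θ.Z3) ∧
    (∀ (j : Fin p) (l : Fin k₂), (j : ℕ) < (l : ℕ) → θ.Λ2 j l = 0) ∧
    (p : ℝ)⁻¹ • (θ.Λ3ᵀ * (diagonal θ.Ψ)⁻¹ * θ.Λ3) = 1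

end GFParams

/-- The random matrix `A` has independent Bernoulli edges with probability matrix `P`
(all of whose entries lie in `[0, 1]`): it is symmetric with zero diagonal, and its entries above
the diagonal are independent with `A i j ∼ Bernoulli (P i j)`. -/
structure IsBernoulliNetwork {Ω : Type*} [MeasurableSpace Ω] (μ : Measure Ω) {n : ℕ}
    (A : Ω → Matrix (Fin n) (Fin n) ℝ) (P : Matrix (Fin n) (Fin n) ℝ) : Prop where
  mem_unit : ∀ i j, P i j ∈ unitInterval
  symm_zero_diag : ∀ᵐ ω ∂μ, (A ω).IsSymm ∧ ∀ i, A ω i i = 0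
  indep : iIndepFun (fun (e : {e : Fin n × Fin n // e.1 < e.2}) (ω : Ω) ↦ A ω e.1.1 e.1.2) μ
  law : ∀ i j, i < j →
    HasLaw (fun ω ↦ A ω i j) (bernoulliMeasure (1 : ℝ) 0 ⟨P i j, mem_unit i j⟩) μ

/-- The projection matrix onto the span of the all-ones vector, `1 1ᵀ / n`. -/
def onesProj (n : ℕ) : Matrix (Fin n) (Fin n) ℝ :=
  (n : ℝ)⁻¹ • vecMulVec 1 1

/-- `α̂ = n⁻¹ (I - P₁ / 2) A 1`. -/
def alphaHat {n : ℕ} (A : Matrix (Fin n) (Fin n) ℝ) : Fin n → ℝ :=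
  (n : ℝ)⁻¹ • (((1 : Matrix (Fin n) (Fin n) ℝ) - (2 : ℝ)⁻¹ • onesProj n) * A) *ᵥ 1

/-- The vector with `i`-th entry `n⁻¹ ∑_{j ≠ i} xᵢᵀxⱼ (1 - xᵢᵀxⱼ)`, `xᵢ` the `i`-th row of `X`. -/
def edgeVariance {n d : ℕ} (X : Matrix (Fin n) (Fin d) ℝ) : Fin n → ℝ := fun i ↦
  (n : ℝ)⁻¹ * ∑ j ∈ Finset.univ.erase i, (X i ⬝ᵥ X j) * (1 - X i ⬝ᵥ X j)

end

/-!
The map `A ↦ α̂` is linear and sends `P` to `α`, since the columns of `Z₁₂` sum to zero.  Hence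
`√n (α̂ᵢ - αᵢ)` is the image of `A - P`: a weighted sum of the independent centred variables
`Aₖⱼ - Pₖⱼ`, `k < j`, plus a deterministic bias of size at most `n^(-1/2)` which comes from the zero
diagonal of `A`.  The weights are at most `n^(-1/2)` in absolute value, so comparing each summand
with a Gaussian of the same variance `vₑ` changes the characteristic function at `t`, `|t| ≤ √n`, by
at most `|t|³ n^(-1/2) ∑ₑ vₑ` in total.  Finally `∑ₑ vₑ` differs from
`(1 - 2/n) n⁻¹ ∑_{j ≠ i} Pᵢⱼ (1 - Pᵢⱼ)` by at most `1/n`: the edges at `i` have weight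
`n^(-1/2) (1 - 1/n)`, all others `-n^(-3/2)`.
-/

section NormalApproximation

theorem norm_prod_sub_prod_le_sum_norm_sub {ι R : Type*} [NormedCommRing R] [NormOneClass R]
    (s : Finset ι) {f g : ι → R} (hf : ∀ i ∈ s, ‖f i‖ ≤ 1) (hg : ∀ i ∈ s, ‖g i‖ ≤ 1) :
    ‖∏ i ∈ s, f i - ∏ i ∈ s, g i‖ ≤ ∑ i ∈ s, ‖f i - g i‖ := by
  classical
  induction s using Finset.induction_on with
  | empty => simp
  | insert a s ha ih =>
    simp only [Finset.forall_mem_insert] at hf hg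
    rw [Finset.prod_insert ha, Finset.prod_insert ha, Finset.sum_insert ha]
    have hs : ‖∏ i ∈ s, f i‖ ≤ 1 :=
      (s.norm_prod_le f).trans (Finset.prod_le_one (fun i _ ↦ norm_nonneg _) hf.2)
    calc ‖f a * ∏ i ∈ s, f i - g a * ∏ i ∈ s, g i‖
        = ‖(f a - g a) * ∏ i ∈ s, f i + g a * (∏ i ∈ s, f i - ∏ i ∈ s, g i)‖ := by ring_nf
      _ ≤ ‖f a - g a‖ * ‖∏ i ∈ s, f i‖ + ‖g a‖ * ‖∏ i ∈ s, f i - ∏ i ∈ s, g i‖ :=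
          (norm_add_le _ _).trans (add_le_add (norm_mul_le _ _) (norm_mul_le _ _))
      _ ≤ ‖f a - g a‖ * 1 + 1 * ∑ i ∈ s, ‖f i - g i‖ := by
          gcongr
          exacts [hg.1, ih hf.2 hg.2]
      _ = ‖f a - g a‖ + ∑ i ∈ s, ‖f i - g i‖ := by rw [mul_one, one_mul]

theorem norm_exp_ofReal_mul_I_sub_taylor_two_le {x : ℝ} (hx : |x| ≤ 1) :
    ‖Complex.exp (x * Complex.I) - (1 + x * Complex.I - x ^ 2 / 2)‖ ≤ |x| ^ 3 / 4 := by
  have hnorm : ‖(x : ℂ) * Complex.I‖ = |x| := by simp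
  have hsum : ∑ m ∈ Finset.range 3, ((x : ℂ) * Complex.I) ^ m / m.factorial =
      1 + x * Complex.I - x ^ 2 / 2 := by
    simp only [mul_pow, Finset.sum_range_succ, Finset.range_one, Finset.sum_singleton, pow_zero,
      Nat.factorial, Nat.cast_one, pow_one, Complex.I_sq, Nat.cast_mul, Nat.succ_eq_add_one]
    push_cast
    ring
  have hbound := Complex.exp_bound (x := x * Complex.I) (hnorm.trans_le hx) (n := 3) (by norm_num)
  rw [hsum, hnorm] at hbound
  refine hbound.trans ?_
  rw [div_eq_mul_inv]
  gcongr
  norm_num [Nat.factorial]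

variable {Ω : Type*} [MeasurableSpace Ω] {μ : Measure Ω} [IsProbabilityMeasure μ]

theorem norm_charFun_map_sub_taylor_two_le {Y : Ω → ℝ} {ε t : ℝ} (hY : AEMeasurable Y μ)
    (hmean : μ[Y] = 0) (hbdd : ∀ᵐ ω ∂μ, |Y ω| ≤ ε) (ht : |t| * ε ≤ 1) :
    ‖charFun (μ.map Y) t - (1 - (t ^ 2 * Var[Y; μ] / 2 : ℝ))‖ ≤
      |t| ^ 3 * ε * Var[Y; μ] / 4 := by
  have hYsq : Integrable (fun ω ↦ Y ω ^ 2) μ :=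
    (MemLp.of_bound hY.aestronglyMeasurable ε hbdd).integrable_sq
  have hYint : Integrable Y μ := (MemLp.of_bound hY.aestronglyMeasurable ε hbdd).integrable le_rfl
  have hlin : Integrable (fun ω ↦ 1 + (t * Y ω : ℝ) * Complex.I) μ :=
    (integrable_const 1).add ((hYint.const_mul t).ofReal.mul_const _)
  have hquad : Integrable (fun ω ↦ ((t ^ 2 / 2 * Y ω ^ 2 : ℝ) : ℂ)) μ :=
    (hYsq.const_mul (t ^ 2 / 2)).ofReal
  have hexp : Integrable (fun ω ↦ Complex.exp ((t * Y ω : ℝ) * Complex.I)) μ :=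
    .of_bound (by fun_prop) 1 (.of_forall fun ω ↦ (Complex.norm_exp_ofReal_mul_I _).le)
  have hcharFun : charFun (μ.map Y) t = ∫ ω, Complex.exp ((t * Y ω : ℝ) * Complex.I) ∂μ := by
    rw [charFun_apply_real, integral_map hY (by fun_prop)]
    simp
  have htaylor : (1 - (t ^ 2 * Var[Y; μ] / 2 : ℝ) : ℂ) =
      ∫ ω, (1 + (t * Y ω : ℝ) * Complex.I - (t ^ 2 / 2 * Y ω ^ 2 : ℝ)) ∂μ := by
    rw [integral_sub hlin hquad, integral_add (integrable_const 1)
        ((hYint.const_mul t).ofReal.mul_const _), integral_mul_const, integral_complex_ofReal,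
      integral_complex_ofReal, integral_const_mul, integral_const_mul, hmean,
      variance_of_integral_eq_zero hY hmean]
    simp only [integral_const, probReal_univ, one_smul]
    push_cast
    ring
  rw [hcharFun, htaylor, ← integral_sub hexp (by exact hlin.sub hquad),
    variance_of_integral_eq_zero hY hmean, mul_div_right_comm, ← integral_const_mul]
  refine norm_integral_le_of_norm_le (hYsq.const_mul _) ?_
  filter_upwards [hbdd] with ω hω
  have htY : |t * Y ω| ≤ 1 := by
    rw [abs_mul]
    exact (mul_le_mul_of_nonneg_left hω (abs_nonneg t)).trans ht
  calc _ = ‖Complex.exp ((t * Y ω : ℝ) * Complex.I) -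
          (1 + (t * Y ω : ℝ) * Complex.I - (t * Y ω : ℝ) ^ 2 / 2)‖ := by
        push_cast
        ring_nf
    _ ≤ |t * Y ω| ^ 3 / 4 := norm_exp_ofReal_mul_I_sub_taylor_two_le htY
    _ = |t| ^ 3 * |Y ω| / 4 * Y ω ^ 2 := by rw [abs_mul, ← sq_abs (Y ω)]; ring
    _ ≤ |t| ^ 3 * ε / 4 * Y ω ^ 2 := by gcongr

theorem charFun_gaussianReal_zero_toNNReal {v : ℝ} (hv : 0 ≤ v) (t : ℝ) :
    charFun (gaussianReal 0 v.toNNReal) t = Complex.exp ((-(t ^ 2 * v / 2) : ℝ)) := by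
  rw [charFun_gaussianReal]
  congr 1
  simp [hv, mul_comm]

theorem norm_charFun_map_sub_charFun_gaussianReal_le {Y : Ω → ℝ} {ε t : ℝ}
    (hY : AEMeasurable Y μ) (hmean : μ[Y] = 0) (hbdd : ∀ᵐ ω ∂μ, |Y ω| ≤ ε) (ht : |t| * ε ≤ 1) :
    ‖charFun (μ.map Y) t - charFun (gaussianReal 0 Var[Y; μ].toNNReal) t‖ ≤
      |t| ^ 3 * ε * Var[Y; μ] := by
  have hε : 0 ≤ ε := hbdd.exists.elim fun ω hω ↦ (abs_nonneg _).trans hω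
  have hvar0 : 0 ≤ Var[Y; μ] := variance_nonneg _ _
  have hvar : Var[Y; μ] ≤ ε ^ 2 := by
    simpa [← two_mul] using variance_le_sq_of_bounded (hbdd.mono fun ω ↦ abs_le.1) hY
  have hsq : t ^ 2 * Var[Y; μ] ≤ |t| * ε :=
    calc t ^ 2 * Var[Y; μ] ≤ |t| ^ 2 * ε ^ 2 := by rw [sq_abs]; gcongr
      _ = |t| * ε * (|t| * ε) := by ring
      _ ≤ |t| * ε := mul_le_of_le_one_right (by positivity) ht
  set y : ℝ := -(t ^ 2 * Var[Y; μ] / 2) with hy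
  have hexp : ‖(1 + y : ℝ) - Real.exp y‖ ≤ y ^ 2 := by
    rw [norm_sub_rev, ← sub_sub, ← sq_abs]
    refine Real.norm_exp_sub_one_sub_id_le ?_
    rw [hy, norm_neg, Real.norm_of_nonneg (by positivity)]
    linarith
  calc ‖charFun (μ.map Y) t - charFun (gaussianReal 0 Var[Y; μ].toNNReal) t‖
      = ‖(charFun (μ.map Y) t - (1 - (t ^ 2 * Var[Y; μ] / 2 : ℝ))) +
          (((1 + y : ℝ) - Real.exp y : ℝ) : ℂ)‖ := by
        rw [charFun_gaussianReal_zero_toNNReal hvar0, ← hy, Complex.ofReal_sub, Complex.ofReal_exp,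
          hy]
        push_cast
        ring_nf
    _ ≤ |t| ^ 3 * ε * Var[Y; μ] / 4 + y ^ 2 :=
        (norm_add_le _ _).trans (add_le_add (norm_charFun_map_sub_taylor_two_le hY hmean hbdd ht)
          ((Complex.norm_real _).trans_le hexp))
    _ = |t| ^ 3 * ε * Var[Y; μ] / 4 + t ^ 2 * Var[Y; μ] * (t ^ 2 * Var[Y; μ]) / 4 := by
        rw [hy]
        ring
    _ ≤ |t| ^ 3 * ε * Var[Y; μ] / 4 + |t| * ε * (t ^ 2 * Var[Y; μ]) / 4 := by gcongr
    _ = |t| ^ 3 * ε * Var[Y; μ] / 2 := by rw [← sq_abs t]; ring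
    _ ≤ |t| ^ 3 * ε * Var[Y; μ] := half_le_self (by positivity)

theorem charFun_gaussianReal_sum_toNNReal {ι : Type*} (s : Finset ι) {v : ι → ℝ}
    (hv : ∀ i ∈ s, 0 ≤ v i) (t : ℝ) :
    charFun (gaussianReal 0 (∑ i ∈ s, v i).toNNReal) t =
      ∏ i ∈ s, charFun (gaussianReal 0 (v i).toNNReal) t := by
  rw [charFun_gaussianReal_zero_toNNReal (Finset.sum_nonneg hv),
    Finset.prod_congr rfl fun i hi ↦ charFun_gaussianReal_zero_toNNReal (hv i hi) t,
    ← Complex.exp_sum, ← Complex.ofReal_sum, Finset.sum_neg_distrib, ← Finset.sum_div,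
    Finset.mul_sum]

theorem norm_charFun_map_sum_sub_charFun_gaussianReal_le {ι : Type*} [Fintype ι]
    {Y : ι → Ω → ℝ} {ε t : ℝ} (hY : ∀ i, AEMeasurable (Y i) μ) (hindep : iIndepFun Y μ)
    (hmean : ∀ i, μ[Y i] = 0) (hbdd : ∀ i, ∀ᵐ ω ∂μ, |Y i ω| ≤ ε) (ht : |t| * ε ≤ 1) :
    ‖charFun (μ.map fun ω ↦ ∑ i, Y i ω) t -
        charFun (gaussianReal 0 (∑ i, Var[Y i; μ]).toNNReal) t‖ ≤
      |t| ^ 3 * ε * ∑ i, Var[Y i; μ] := by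
  have hprob (i : ι) : IsProbabilityMeasure (μ.map (Y i)) := Measure.isProbabilityMeasure_map (hY i)
  rw [hindep.charFun_map_fun_sum_eq_prod hY, Finset.prod_apply,
    charFun_gaussianReal_sum_toNNReal _ fun i _ ↦ variance_nonneg _ _, Finset.mul_sum]
  exact (norm_prod_sub_prod_le_sum_norm_sub _ (fun i _ ↦ norm_charFun_le_one _)
    fun i _ ↦ norm_charFun_le_one _).trans <| Finset.sum_le_sum fun i _ ↦
      norm_charFun_map_sub_charFun_gaussianReal_le (hY i) (hmean i) (hbdd i) ht

theorem norm_charFun_map_add_const_sub {E : Type*} [NormedAddCommGroup E] [InnerProductSpace ℝ E]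
    [MeasurableSpace E] [BorelSpace E] (ν ρ : Measure E) (b t : E) :
    ‖charFun (ν.map (· + b)) t - charFun (ρ.map (· + b)) t‖ = ‖charFun ν t - charFun ρ t‖ := by
  rw [charFun_map_add_const, charFun_map_add_const, ← sub_mul, norm_mul,
    Complex.norm_exp_ofReal_mul_I, mul_one]

theorem tendstoInDistribution_gaussianReal_of_tendsto_charFun_sub {Ω : ℕ → Type*}
    [∀ n, MeasurableSpace (Ω n)] {μ : ∀ n, Measure (Ω n)} [∀ n, IsProbabilityMeasure (μ n)]
    {Y : ∀ n, Ω n → ℝ} (hY : ∀ n, AEMeasurable (Y n) (μ n)) {m v : ℕ → ℝ} {m₀ v₀ : ℝ}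
    (hm : Tendsto m atTop (𝓝 m₀)) (hv : Tendsto v atTop (𝓝 v₀))
    (h : ∀ t, Tendsto (fun n ↦ charFun ((μ n).map (Y n)) t -
      charFun (gaussianReal (m n) (v n).toNNReal) t) atTop (𝓝 0)) :
    TendstoInDistribution Y atTop (id : ℝ → ℝ) μ (gaussianReal m₀ v₀.toNNReal) := by
  refine ⟨hY, aemeasurable_id, ProbabilityMeasure.tendsto_of_tendsto_charFun fun t ↦ ?_⟩
  have hgauss : Tendsto (fun n ↦ charFun (gaussianReal (m n) (v n).toNNReal) t) atTop
      (𝓝 (charFun (gaussianReal m₀ v₀.toNNReal) t)) := by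
    have hcont : Continuous fun x : ℝ × ℝ ↦
        Complex.exp (t * x.1 * Complex.I - x.2.toNNReal * t ^ 2 / 2) := by fun_prop
    simpa only [charFun_gaussianReal, Function.comp_def] using
      (hcont.tendsto (m₀, v₀)).comp (hm.prodMk_nhds hv)
  simpa using (h t).add hgauss

end NormalApproximation

section Bernoulli

theorem integral_id_bernoulliMeasure_one_zero (q : unitInterval) :
    ∫ x, x ∂bernoulliMeasure (1 : ℝ) 0 q = q := by
  simp [integral_bernoulliMeasure]

theorem variance_id_bernoulliMeasure_one_zero (q : unitInterval) :
    Var[id; bernoulliMeasure (1 : ℝ) 0 q] = q * (1 - q) := by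
  rw [variance_eq_integral aemeasurable_id]
  simp only [id_eq, integral_bernoulliMeasure, smul_eq_mul]
  ring

theorem ae_mem_unitInterval_bernoulliMeasure_one_zero (q : unitInterval) :
    ∀ᵐ x ∂bernoulliMeasure (1 : ℝ) 0 q, x ∈ unitInterval :=
  bernoulliMeasure_apply_of_notMem_of_notMem q measurableSet_Icc.compl
    (not_not.2 unitInterval.one_mem) (not_not.2 unitInterval.zero_mem)

variable {Ω ι : Type*} [MeasurableSpace Ω] {μ : Measure Ω} [IsProbabilityMeasure μ]

theorem norm_charFun_map_sum_bernoulli_sub_charFun_gaussianReal_le [Fintype ι] {Y : ι → Ω → ℝ}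
    {q : ι → unitInterval} (hindep : iIndepFun Y μ)
    (hY : ∀ e, HasLaw (Y e) (bernoulliMeasure (1 : ℝ) 0 (q e)) μ) {c : ι → ℝ} {ε t : ℝ}
    (hc : ∀ e, |c e| ≤ ε) (ht : |t| * ε ≤ 1) :
    ‖charFun (μ.map fun ω ↦ ∑ e, c e * (Y e ω - q e)) t -
        charFun (gaussianReal 0 (∑ e, c e ^ 2 * (q e * (1 - q e))).toNNReal) t‖ ≤
      |t| ^ 3 * ε * ∑ e, c e ^ 2 * (q e * (1 - q e)) := by
  have hYm (e : ι) : AEMeasurable (Y e) μ := (hY e).aemeasurable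
  have hunit (e : ι) : ∀ᵐ ω ∂μ, Y e ω ∈ unitInterval :=
    ((hY e).ae_iff measurableSet_Icc.mem).2 (ae_mem_unitInterval_bernoulliMeasure_one_zero _)
  have hint (e : ι) : Integrable (Y e) μ :=
    .of_bound (hYm e).aestronglyMeasurable 1 <| (hunit e).mono fun ω hω ↦
      abs_le.2 ⟨by linarith [hω.1], hω.2⟩
  have hvar (e : ι) : Var[fun ω ↦ c e * (Y e ω - q e); μ] = c e ^ 2 * (q e * (1 - q e)) := by
    rw [variance_const_mul, variance_sub_const (hYm e).aestronglyMeasurable, (hY e).variance_eq,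
      variance_id_bernoulliMeasure_one_zero]
  simp_rw [← hvar]
  refine norm_charFun_map_sum_sub_charFun_gaussianReal_le (fun e ↦ by fun_prop)
    (hindep.comp (fun e y ↦ c e * (y - q e)) fun e ↦ by fun_prop) (fun e ↦ ?_) (fun e ↦ ?_) ht
  · rw [integral_const_mul, integral_sub (hint e) (integrable_const _), (hY e).integral_eq,
      integral_id_bernoulliMeasure_one_zero]
    simp
  · filter_upwards [hunit e] with ω hω
    have hdiff : |Y e ω - q e| ≤ 1 := by
      simpa [Real.dist_eq] using Real.dist_le_of_mem_Icc hω (q e).2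
    rw [abs_mul]
    exact (mul_le_of_le_one_right (abs_nonneg _) hdiff).trans (hc e)

end Bernoulli

section AlphaHat

/-- The edges of the complete graph on `ι`, encoded as increasing pairs of vertices.  For
`ι = Fin n` they index the independent entries of a Bernoulli network. -/
abbrev Edge (ι : Type*) [LT ι] : Type _ := {e : ι × ι // e.1 < e.2}

theorem sum_sum_eq_sum_edge_add_sum_diag {ι M : Type*} [Fintype ι] [LinearOrder ι]
    [AddCommMonoid M] (f : ι → ι → M) :
    ∑ k, ∑ j, f k j = ∑ e : Edge ι, (f e.1.1 e.1.2 + f e.1.2 e.1.1) + ∑ k, f k k := by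
  have hedge (g : ι → ι → M) :
      ∑ e : Edge ι, g e.1.1 e.1.2 = ∑ k, ∑ j, if k < j then g k j else 0 := by
    rw [← Finset.sum_product', Finset.univ_product_univ, ← Finset.sum_filter]
    exact (Finset.sum_subtype _ (by simp) fun e : ι × ι ↦ g e.1 e.2).symm
  have hdiag : ∑ k, f k k = ∑ k, ∑ j, if k = j then f k j else 0 := by simp
  rw [Finset.sum_add_distrib, hedge f, hedge fun k j ↦ f j k,
    Finset.sum_comm (f := fun k j ↦ if k < j then f j k else 0), hdiag]
  simp_rw [← Finset.sum_add_distrib]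
  refine Finset.sum_congr rfl fun k _ ↦ Finset.sum_congr rfl fun j _ ↦ ?_
  rcases lt_trichotomy k j with h | h | h
  · simp [h, h.ne, h.not_gt]
  · simp [h]
  · simp [h, h.ne', h.not_gt]

variable {n : ℕ}

theorem alphaHat_apply (M : Matrix (Fin n) (Fin n) ℝ) (i : Fin n) :
    alphaHat M i = (n : ℝ)⁻¹ * (∑ j, M i j - (2 * n : ℝ)⁻¹ * ∑ k, ∑ j, M k j) := by
  simp only [alphaHat, onesProj, ← mulVec_mulVec, sub_mulVec, one_mulVec, smul_mulVec,
    Pi.smul_apply, Pi.sub_apply, smul_eq_mul]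
  simp only [mulVec, dotProduct, vecMulVec_apply, Pi.one_apply, mul_one, one_mul, mul_inv,
    mul_assoc]

theorem alphaHat_sub_apply (M N : Matrix (Fin n) (Fin n) ℝ) (i : Fin n) :
    alphaHat (M - N) i = alphaHat M i - alphaHat N i := by
  simp only [alphaHat_apply, Matrix.sub_apply, Finset.sum_sub_distrib]
  ring

theorem alphaHat_vecMulVec_add {α : Fin n → ℝ} {B : Matrix (Fin n) (Fin n) ℝ}
    (hB : ∀ k, ∑ j, B k j = 0) : alphaHat (vecMulVec α 1 + vecMulVec 1 α + B) = α := by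
  ext i
  have hn : (n : ℝ) ≠ 0 := Nat.cast_ne_zero.2 i.pos.ne'
  have hrow (k : Fin n) :
      ∑ j, (vecMulVec α 1 + vecMulVec 1 α + B : Matrix _ _ ℝ) k j = n * α k + ∑ j, α j := by
    simp [Finset.sum_add_distrib, hB]
  simp only [alphaHat_apply, hrow, Finset.sum_add_distrib, ← Finset.mul_sum]
  simp only [Finset.sum_const, Finset.card_univ, Fintype.card_fin, nsmul_eq_mul]
  field

theorem GFParams.alphaHat_P {p k₁ k₂ k₃ : ℕ} {θ : GFParams n p k₁ k₂ k₃}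
    (hZ : IsCentered θ.Z12) : alphaHat θ.P = θ.α := by
  refine alphaHat_vecMulVec_add fun k ↦ ?_
  simp only [mul_apply, transpose_apply]
  rw [Finset.sum_comm]
  simp only [← Finset.mul_sum, hZ _, mul_zero, Finset.sum_const_zero]

theorem GFParams.isCentered_Z12 {p k₁ k₂ k₃ : ℕ} {θ : GFParams n p k₁ k₂ k₃}
    (hθ : θ.Ident1 ∨ θ.Ident2 ∨ θ.Ident3) : IsCentered θ.Z12 := by
  have hZ : IsCentered θ.Z := by rcases hθ with h | h | h <;> exact h.1
  exact fun l ↦ hZ (Sum.inl l)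

theorem GFParams.isSymm_P {p k₁ k₂ k₃ : ℕ} (θ : GFParams n p k₁ k₂ k₃) : θ.P.IsSymm := by
  ext k j
  simp [GFParams.P, mul_apply, mul_comm, add_comm]

/-- The weight of the entry `M k j`, `k < j`, in `√n α̂ᵢ(M)`, for a symmetric matrix `M`. -/
noncomputable def edgeWeight (i : Fin n) (e : Edge (Fin n)) : ℝ :=
  (√(n : ℝ))⁻¹ * ((if e.1.1 = i then 1 else 0) + (if e.1.2 = i then 1 else 0) - (n : ℝ)⁻¹)

/-- The contribution of the diagonal of `P` to `√n α̂ᵢ(P)`, with the opposite sign.  It is the bias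
of `√n α̂ᵢ` for a network with edge probabilities `P`, whose adjacency matrix has zero diagonal. -/
noncomputable def alphaHatBias (P : Matrix (Fin n) (Fin n) ℝ) (i : Fin n) : ℝ :=
  (√(n : ℝ))⁻¹ * ((2 * n : ℝ)⁻¹ * P.trace - P i i)

theorem sum_row_eq_sum_edge_add_diag {M : Matrix (Fin n) (Fin n) ℝ} (hM : M.IsSymm) (i : Fin n) :
    ∑ j, M i j = ∑ e : Edge (Fin n),
      ((if e.1.1 = i then 1 else 0) + if e.1.2 = i then 1 else 0) * M e.1.1 e.1.2 + M i i := by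
  have hpairs := sum_sum_eq_sum_edge_add_sum_diag fun k j ↦ if k = i then M k j else 0
  rw [Finset.sum_comm] at hpairs
  simpa [hM.apply, add_mul] using hpairs

theorem sqrt_mul_alphaHat_eq_sum_edge {M : Matrix (Fin n) (Fin n) ℝ} (hM : M.IsSymm) (i : Fin n) :
    √(n : ℝ) * alphaHat M i =
      ∑ e : Edge (Fin n), edgeWeight i e * M e.1.1 e.1.2 - alphaHatBias M i := by
  have hsqrt : √(n : ℝ) * (n : ℝ)⁻¹ = (√(n : ℝ))⁻¹ := by
    rw [← div_eq_mul_inv, Real.sqrt_div_self]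
  have htotal : ∑ k, ∑ j, M k j = 2 * ∑ e : Edge (Fin n), M e.1.1 e.1.2 + M.trace := by
    rw [sum_sum_eq_sum_edge_add_sum_diag fun k j ↦ M k j, trace, Finset.mul_sum]
    simp [hM.apply, two_mul]
  have hweights : ∑ e : Edge (Fin n), edgeWeight i e * M e.1.1 e.1.2 =
      (√(n : ℝ))⁻¹ * (∑ j, M i j - M i i - (n : ℝ)⁻¹ * ∑ e : Edge (Fin n), M e.1.1 e.1.2) := by
    rw [sum_row_eq_sum_edge_add_diag hM, add_sub_cancel_right, Finset.mul_sum,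
      ← Finset.sum_sub_distrib, Finset.mul_sum]
    exact Finset.sum_congr rfl fun e _ ↦ by rw [edgeWeight]; ring
  rw [alphaHat_apply, ← mul_assoc, hsqrt, htotal, hweights, alphaHatBias]
  ring

theorem sqrt_mul_alphaHat_sub_eq_sum_edge {A P : Matrix (Fin n) (Fin n) ℝ} (hA : A.IsSymm)
    (hA0 : ∀ k, A k k = 0) (hP : P.IsSymm) (i : Fin n) :
    √(n : ℝ) * (alphaHat A i - alphaHat P i) =
      ∑ e : Edge (Fin n), edgeWeight i e * (A e.1.1 e.1.2 - P e.1.1 e.1.2) + alphaHatBias P i := by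
  rw [← alphaHat_sub_apply, sqrt_mul_alphaHat_eq_sum_edge (hA.sub hP), sub_eq_add_neg]
  simp only [Matrix.sub_apply, alphaHatBias, trace, diag_apply, hA0, zero_sub,
    Finset.sum_neg_distrib]
  ring

theorem abs_edgeWeight_le (i : Fin n) (e : Edge (Fin n)) : |edgeWeight i e| ≤ (√(n : ℝ))⁻¹ := by
  have hn : (n : ℝ)⁻¹ ≤ 1 := Nat.cast_inv_le_one n
  have hn0 : 0 ≤ (n : ℝ)⁻¹ := by positivity
  rw [edgeWeight, abs_mul, abs_of_nonneg (by positivity)]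
  refine mul_le_of_le_one_right (by positivity) (abs_le.2 ?_)
  split_ifs with hfst hsnd
  · exact absurd (hfst.trans hsnd.symm) e.2.ne
  all_goals constructor <;> linarith

theorem abs_alphaHatBias_le {P : Matrix (Fin n) (Fin n) ℝ} (hP : ∀ k, P k k ∈ unitInterval)
    (i : Fin n) : |alphaHatBias P i| ≤ (√(n : ℝ))⁻¹ := by
  have hn : (0 : ℝ) < n := Nat.cast_pos.2 i.pos
  have htrace0 : 0 ≤ P.trace := Finset.sum_nonneg fun k _ ↦ (hP k).1
  have htrace : P.trace ≤ n := by
    simpa [trace] using Finset.sum_le_sum (s := Finset.univ) fun k _ ↦ (hP k).2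
  have hmean : (2 * n : ℝ)⁻¹ * P.trace ∈ unitInterval :=
    ⟨by positivity, by rw [inv_mul_le_iff₀ (by positivity)]; linarith⟩
  rw [alphaHatBias, abs_mul, abs_of_nonneg (by positivity)]
  refine mul_le_of_le_one_right (by positivity) ?_
  rw [← Real.dist_eq]
  exact (Real.dist_le_of_mem_Icc hmean (hP i)).trans_eq (sub_zero 1)

end AlphaHat

section Variance

variable {n : ℕ}

/-- The vector with `i`-th entry `n⁻¹ ∑_{j ≠ i} Pᵢⱼ (1 - Pᵢⱼ)`, the variance of `n^(-1/2)` times the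
degree of the vertex `i` in a network with edge probabilities `P`. -/
noncomputable def degreeVariance (P : Matrix (Fin n) (Fin n) ℝ) (i : Fin n) : ℝ :=
  (n : ℝ)⁻¹ * ∑ j ∈ Finset.univ.erase i, P i j * (1 - P i j)

theorem edgeVariance_eq_degreeVariance {d : ℕ} (X : Matrix (Fin n) (Fin d) ℝ) :
    edgeVariance X = degreeVariance (X * Xᵀ) := rfl

/-- The variance of `√n α̂ᵢ` for a network with edge probabilities `P`. -/
noncomputable def alphaHatVariance (P : Matrix (Fin n) (Fin n) ℝ) (i : Fin n) : ℝ :=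
  ∑ e : Edge (Fin n), edgeWeight i e ^ 2 * (P e.1.1 e.1.2 * (1 - P e.1.1 e.1.2))

theorem sum_sq_edgeWeight_mul {V : Matrix (Fin n) (Fin n) ℝ} (hV : V.IsSymm) (i : Fin n) :
    ∑ e : Edge (Fin n), edgeWeight i e ^ 2 * V e.1.1 e.1.2 =
      (1 - 2 * (n : ℝ)⁻¹) * ((n : ℝ)⁻¹ * ∑ j ∈ Finset.univ.erase i, V i j) +
        (n : ℝ)⁻¹ ^ 3 * ∑ e : Edge (Fin n), V e.1.1 e.1.2 := by
  have hrow := sum_row_eq_sum_edge_add_diag hV i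
  rw [← Finset.sum_erase_add _ _ (Finset.mem_univ i), add_left_inj] at hrow
  simp only [hrow, Finset.mul_sum, ← Finset.sum_add_distrib]
  -- An edge contains `i` at most once, so its indicator `b` has `(b - n⁻¹)² = (1 - 2n⁻¹) b + n⁻²`.
  refine Finset.sum_congr rfl fun e _ ↦ ?_
  rw [edgeWeight, mul_pow, inv_pow, Real.sq_sqrt (Nat.cast_nonneg n)]
  split_ifs with hfst hsnd
  · exact absurd (hfst.trans hsnd.symm) e.2.ne
  all_goals ring

theorem abs_sum_edge_le {V : Matrix (Fin n) (Fin n) ℝ} {C : ℝ} (hC : 0 ≤ C)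
    (hV : ∀ e : Edge (Fin n), |V e.1.1 e.1.2| ≤ C) :
    |∑ e : Edge (Fin n), V e.1.1 e.1.2| ≤ n ^ 2 * C := by
  have hcard : Fintype.card (Edge (Fin n)) ≤ n ^ 2 := by
    simpa [sq] using Fintype.card_subtype_le fun e : Fin n × Fin n ↦ e.1 < e.2
  calc |∑ e : Edge (Fin n), V e.1.1 e.1.2| ≤ ∑ e : Edge (Fin n), |V e.1.1 e.1.2| :=
        Finset.abs_sum_le_sum_abs _ _
    _ ≤ Fintype.card (Edge (Fin n)) * C := by
        simpa using Finset.sum_le_card_nsmul Finset.univ _ C fun e _ ↦ hV e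
    _ ≤ n ^ 2 * C := by
        gcongr
        exact_mod_cast hcard

theorem abs_alphaHatVariance_sub_le {P : Matrix (Fin n) (Fin n) ℝ} (hP : P.IsSymm)
    (hunit : ∀ k j, P k j ∈ unitInterval) (i : Fin n) :
    |alphaHatVariance P i - (1 - 2 * (n : ℝ)⁻¹) * degreeVariance P i| ≤ (n : ℝ)⁻¹ := by
  have hn : (n : ℝ) ≠ 0 := Nat.cast_ne_zero.2 i.pos.ne'
  set V : Matrix (Fin n) (Fin n) ℝ := Matrix.of fun k j ↦ P k j * (1 - P k j) with hVdef
  have hV : V.IsSymm := by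
    ext k j
    simp [hVdef, hP.apply k j]
  have hV1 (e : Edge (Fin n)) : |V e.1.1 e.1.2| ≤ 1 := by
    have hmem : V e.1.1 e.1.2 ∈ unitInterval :=
      unitInterval.mul_mem (hunit _ _) (Set.Icc.mem_iff_one_sub_mem.1 (hunit _ _))
    exact (abs_of_nonneg hmem.1).trans_le hmem.2
  have hsum : alphaHatVariance P i - (1 - 2 * (n : ℝ)⁻¹) * degreeVariance P i =
      (n : ℝ)⁻¹ ^ 3 * ∑ e : Edge (Fin n), V e.1.1 e.1.2 :=
    sub_eq_of_eq_add' (sum_sq_edgeWeight_mul hV i)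
  calc |alphaHatVariance P i - (1 - 2 * (n : ℝ)⁻¹) * degreeVariance P i|
      = (n : ℝ)⁻¹ ^ 3 * |∑ e : Edge (Fin n), V e.1.1 e.1.2| := by
        rw [hsum, abs_mul, abs_of_nonneg (by positivity)]
    _ ≤ (n : ℝ)⁻¹ ^ 3 * (n ^ 2 * 1) := by
        gcongr
        exact abs_sum_edge_le zero_le_one hV1
    _ = (n : ℝ)⁻¹ := by field

theorem degreeVariance_nonneg {P : Matrix (Fin n) (Fin n) ℝ}
    (hunit : ∀ k j, P k j ∈ unitInterval) (i : Fin n) : 0 ≤ degreeVariance P i :=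
  mul_nonneg (by positivity) <| Finset.sum_nonneg fun j _ ↦
    mul_nonneg (hunit i j).1 (sub_nonneg.2 (hunit i j).2)

end Variance

section BernoulliNetwork

theorem IsBernoulliNetwork.norm_charFun_map_sub_charFun_gaussianReal_le {Ω : Type*}
    [MeasurableSpace Ω] {μ : Measure Ω} [IsProbabilityMeasure μ] {n : ℕ}
    {A : Ω → Matrix (Fin n) (Fin n) ℝ} {P : Matrix (Fin n) (Fin n) ℝ}
    (hA : IsBernoulliNetwork μ A P) (hP : P.IsSymm) (i : Fin n) {t : ℝ}
    (ht : |t| * (√(n : ℝ))⁻¹ ≤ 1) :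
    ‖charFun (μ.map fun ω ↦ √(n : ℝ) * (alphaHat (A ω) i - alphaHat P i)) t -
        charFun (gaussianReal (alphaHatBias P i) (alphaHatVariance P i).toNNReal) t‖ ≤
      |t| ^ 3 * (√(n : ℝ))⁻¹ * alphaHatVariance P i := by
  set S : Ω → ℝ := fun ω ↦
    ∑ e : Edge (Fin n), edgeWeight i e * (A ω e.1.1 e.1.2 - P e.1.1 e.1.2)
  have hentry (e : Edge (Fin n)) : AEMeasurable (fun ω ↦ A ω e.1.1 e.1.2) μ :=
    (hA.law _ _ e.2).aemeasurable
  have hSm : AEMeasurable S μ := by fun_prop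
  have hmap : (μ.map fun ω ↦ √(n : ℝ) * (alphaHat (A ω) i - alphaHat P i)) =
      (μ.map S).map (· + alphaHatBias P i) := by
    rw [AEMeasurable.map_map_of_aemeasurable (by fun_prop) hSm]
    refine Measure.map_congr ?_
    filter_upwards [hA.symm_zero_diag] with ω hω
    exact sqrt_mul_alphaHat_sub_eq_sum_edge hω.1 hω.2 hP i
  have hgauss : gaussianReal (alphaHatBias P i) (alphaHatVariance P i).toNNReal =
      (gaussianReal 0 (alphaHatVariance P i).toNNReal).map (· + alphaHatBias P i) := by
    rw [gaussianReal_map_add_const, zero_add]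
  rw [hmap, hgauss, norm_charFun_map_add_const_sub]
  exact norm_charFun_map_sum_bernoulli_sub_charFun_gaussianReal_le hA.indep
    (fun e ↦ hA.law _ _ e.2) (abs_edgeWeight_le i) ht

theorem entry_of_lt {n i : ℕ} (v : Fin n → ℝ) (hi : i < n) : entry v i = v ⟨i, hi⟩ := dif_pos hi

theorem aemeasurable_entry_alphaHat {Ω : Type*} [MeasurableSpace Ω] {μ : Measure Ω} {n : ℕ}
    {A : Ω → Matrix (Fin n) (Fin n) ℝ} (hA : ∀ k j, AEMeasurable (fun ω ↦ A ω k j) μ) (i : ℕ) :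
    AEMeasurable (fun ω ↦ entry (alphaHat (A ω)) i) μ := by
  by_cases hi : i < n
  · simp only [entry_of_lt _ hi, alphaHat_apply]
    fun_prop
  · simp only [entry, dif_neg hi]
    fun_prop

theorem tendsto_inv_sqrt_natCast_atTop : Tendsto (fun n : ℕ ↦ (√(n : ℝ))⁻¹) atTop (𝓝 0) :=
  (Real.tendsto_sqrt_atTop.comp tendsto_natCast_atTop_atTop).inv_tendsto_atTop

variable {P : ∀ n, Matrix (Fin n) (Fin n) ℝ} {i : ℕ → ℕ}

theorem tendsto_entry_alphaHatBias (hunit : ∀ᶠ n in atTop, ∀ k j, P n k j ∈ unitInterval)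
    (hi : ∀ᶠ n in atTop, i n < n) :
    Tendsto (fun n ↦ entry (alphaHatBias (P n)) (i n)) atTop (𝓝 0) := by
  refine squeeze_zero_norm' ?_ tendsto_inv_sqrt_natCast_atTop
  filter_upwards [hunit, hi] with n hn hin
  rw [entry_of_lt _ hin]
  exact abs_alphaHatBias_le (fun k ↦ hn k k) _

theorem tendsto_entry_alphaHatVariance (hP : ∀ᶠ n in atTop, (P n).IsSymm)
    (hunit : ∀ᶠ n in atTop, ∀ k j, P n k j ∈ unitInterval) (hi : ∀ᶠ n in atTop, i n < n) {Q : ℝ}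
    (hQ : Tendsto (fun n ↦ entry (degreeVariance (P n)) (i n)) atTop (𝓝 Q)) :
    Tendsto (fun n ↦ entry (alphaHatVariance (P n)) (i n)) atTop (𝓝 Q) := by
  have hscaled : Tendsto (fun n : ℕ ↦ (1 - 2 * (n : ℝ)⁻¹) * entry (degreeVariance (P n)) (i n))
      atTop (𝓝 Q) := by
    simpa using ((tendsto_inv_atTop_nhds_zero_nat (𝕜 := ℝ)).const_mul 2).const_sub 1 |>.mul hQ
  have hdiff : Tendsto (fun n : ℕ ↦ entry (alphaHatVariance (P n)) (i n) -
      (1 - 2 * (n : ℝ)⁻¹) * entry (degreeVariance (P n)) (i n)) atTop (𝓝 0) := by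
    refine squeeze_zero_norm' ?_ (tendsto_inv_atTop_nhds_zero_nat (𝕜 := ℝ))
    filter_upwards [hP, hunit, hi] with n hPn hn hin
    rw [entry_of_lt _ hin, entry_of_lt _ hin]
    exact abs_alphaHatVariance_sub_le hPn hn _
  simpa using hdiff.add hscaled

end BernoulliNetwork

theorem theorem3_general {Ω : ℕ → Type*} [∀ n, MeasurableSpace (Ω n)] {μ : ∀ n, Measure (Ω n)}
    [∀ n, IsProbabilityMeasure (μ n)] {A : ∀ n, Ω n → Matrix (Fin n) (Fin n) ℝ}
    {P : ∀ n, Matrix (Fin n) (Fin n) ℝ} {α : ∀ n, Fin n → ℝ}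
    (hAmeas : ∀ n k j, AEMeasurable (fun ω ↦ A n ω k j) (μ n))
    (hA : ∀ᶠ n in atTop, IsBernoulliNetwork (μ n) (A n) (P n))
    (hP : ∀ᶠ n in atTop, (P n).IsSymm) (hα : ∀ᶠ n in atTop, alphaHat (P n) = α n)
    {i : ℕ → ℕ} (hi : ∀ᶠ n in atTop, i n < n) {Q : ℝ}
    (hQ : Tendsto (fun n ↦ entry (degreeVariance (P n)) (i n)) atTop (𝓝 Q)) :
    0 ≤ Q ∧
    TendstoInDistribution
      (fun (n : ℕ) ω ↦ √(n : ℝ) * (entry (alphaHat (A n ω)) (i n) - entry (α n) (i n))) atTop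
      (id : ℝ → ℝ) μ (gaussianReal 0 Q.toNNReal) := by
  have hunit : ∀ᶠ n in atTop, ∀ k j, P n k j ∈ unitInterval := hA.mono fun n h ↦ h.mem_unit
  have hvar := tendsto_entry_alphaHatVariance hP hunit hi hQ
  refine ⟨ge_of_tendsto hQ ?_, tendstoInDistribution_gaussianReal_of_tendsto_charFun_sub
    (fun n ↦ ((aemeasurable_entry_alphaHat (hAmeas n) _).sub_const _).const_mul _)
    (tendsto_entry_alphaHatBias hunit hi) hvar fun t ↦ ?_⟩
  · filter_upwards [hunit, hi] with n hn hin
    exact (degreeVariance_nonneg hn _).trans_eq (entry_of_lt _ hin).symm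
  have hsmall : ∀ᶠ n : ℕ in atTop, |t| * (√(n : ℝ))⁻¹ ≤ 1 :=
    (tendsto_inv_sqrt_natCast_atTop.const_mul |t|).eventually_le_const (by simp)
  have hbound : Tendsto (fun n : ℕ ↦
      |t| ^ 3 * (√(n : ℝ))⁻¹ * entry (alphaHatVariance (P n)) (i n)) atTop (𝓝 0) := by
    simpa using (tendsto_inv_sqrt_natCast_atTop.const_mul (|t| ^ 3)).mul hvar
  refine squeeze_zero_norm' ?_ hbound
  filter_upwards [hA, hP, hα, hi, hsmall] with n hAn hPn hαn hin ht
  simp only [entry_of_lt _ hin, ← hαn]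
  exact hAn.norm_charFun_map_sub_charFun_gaussianReal_le hPn _ ht

theorem theorem3 {k₁ k₂ k₃ d : ℕ} (p : ℕ → ℕ)
    -- for every `n`: parameters, a probability space and a random matrix `A n`
    (θ : ∀ n, GFParams n (p n) k₁ k₂ k₃)
    {Ω : ℕ → Type*} [∀ n, MeasurableSpace (Ω n)]
    (μ : ∀ n, Measure (Ω n)) [∀ n, IsProbabilityMeasure (μ n)]
    (A : ∀ n, Ω n → Matrix (Fin n) (Fin n) ℝ)
    (hAmeas : ∀ n i j, Measurable fun ω ↦ A n ω i j)
    -- the network model (symmetric adjacency matrix with zero diagonal)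
    (hA : ∀ᶠ n in atTop, IsBernoulliNetwork (μ n) (A n) (θ n).P)
    -- `P` is positive semidefinite, and the largest expected degree is not too small
    (hPsd : ∀ᶠ n in atTop, (θ n).P.PosSemidef)
    (hdeg : ∃ a : ℝ, 0 < a ∧
      ∀ᶠ n : ℕ in atTop, ∃ i, Real.log (n : ℝ) ^ (4 + a) < ∑ j, (θ n).P i j)
    -- boundedness of the factor model parameters
    (hbdd : ∃ C : ℝ, 0 < C ∧
      (∀ᶠ n in atTop, ∀ j, 0 < (θ n).Ψ j ∧ (θ n).Ψ j ≤ C ∧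
        ‖WithLp.toLp 2 ((θ n).Λ j)‖ ≤ C) ∧
      ∀ MZ, Tendsto (fun n : ℕ ↦ (n : ℝ)⁻¹ • ((θ n).Zᵀ * (θ n).Z)) atTop (𝓝 MZ) →
        ∀ a b, |MZ a b| ≤ C)
    -- identifiability
    (hident : ∀ᶠ n in atTop, (θ n).Ident1 ∨ (θ n).Ident2 ∨ (θ n).Ident3)
    -- `P = X Xᵀ`, and the existence of the limits
    (X : ∀ n, Matrix (Fin n) (Fin d) ℝ) (hX : ∀ᶠ n in atTop, (θ n).P = X n * (X n)ᵀ)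
    (MX : Matrix (Fin d) (Fin d) ℝ)
    (hMX : Tendsto (fun n : ℕ ↦ (n : ℝ)⁻¹ • ((X n)ᵀ * X n)) atTop (𝓝 MX))
    (i : ℕ) (Q : ℝ) (hQ : Tendsto (fun n ↦ entry (edgeVariance (X n)) i) atTop (𝓝 Q)) :
    0 ≤ Q ∧
    TendstoInDistribution
      (fun (n : ℕ) ω ↦ √(n : ℝ) * (entry (alphaHat (A n ω)) i - entry (θ n).α i)) atTop
      (id : ℝ → ℝ) μ (gaussianReal 0 Q.toNNReal) :=
  theorem3_general (fun n k j ↦ (hAmeas n k j).aemeasurable) hA (.of_forall fun n ↦ (θ n).isSymm_P)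
    (hident.mono fun _ h ↦ GFParams.alphaHat_P (GFParams.isCentered_Z12 h)) (eventually_gt_atTop i)
    (hQ.congr' (hX.mono fun n h ↦ by simp only [h, edgeVariance_eq_degreeVariance]))
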